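/- Let $E$ be a real Banach lattice, let $K$ be a compact Hausdorff space such that the space $C(K)$ of continuous real-valued functions on $K$ (with the supremum norm and the pointwise order) is separable, and let $I$ be a closed order ideal of $C(K)$, i.e. a closed linear subspace such that $g \in I$ whenever $g \in C(K)$ and $|g| \le |f|$ for some $f \in I$. Suppose that $E$ is order isomorphic to $I$, i.e. there is a (not necessarily linear) bijection $T : E \to I$ such that $x \ge y$ if and only if $Tx \ge Ty$ for all $x, y \in E$. Then $E$ is lattice isomorphic to an AM-space: there are a Banach lattice $F$ whose norm satisfies $\|x \vee y\| = \max\{\|x\|, \|y\|\}$ for all $x, y \ge 0$ in $F$, and a linear bijection $S : E \to F$ such that $S|x| = |Sx|$ for all $x \in E$. -/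

import Mathlib

universe u v

/-- The norm of a normed lattice `F` is an M-norm: `‖x ⊔ y‖ = max ‖x‖ ‖y‖` for all positive `x`, `y`.
A Banach lattice with this property is an AM-space. -/
def HasMNorm (F : Type*) [NormedAddCommGroup F] [Lattice F] : Prop :=
  ∀ x y : F, 0 ≤ x → 0 ≤ y → ‖x ⊔ y‖ = max ‖x‖ ‖y‖

/-- Two real vector lattices are lattice isomorphic if there is a linear bijection `T` between them
with `T |x| = |T x|` for all `x`. -/
def LatticeIsomorphic (E F : Type*) [AddCommGroup E] [Module ℝ E] [Lattice E]
    [AddCommGroup F] [Module ℝ F] [Lattice F] : Prop :=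
  ∃ T : E ≃ₗ[ℝ] F, ∀ x : E, T |x| = |T x|

/-- A real Banach lattice `E` is lattice isomorphic to an AM-space, that is, to a Banach lattice
whose norm is an M-norm. -/
def LatticeIsomorphicToAMSpace (E : Type u) [AddCommGroup E] [Module ℝ E] [Lattice E] : Prop :=
  ∃ (F : Type u) (_ : NormedAddCommGroup F) (_ : NormedSpace ℝ F) (_ : CompleteSpace F)
    (_ : Lattice F) (_ : IsOrderedAddMonoid F) (_ : IsOrderedModule ℝ F) (_ : HasSolidNorm F),
    HasMNorm F ∧ LatticeIsomorphic E F

/-- A linear subspace `I` of a vector lattice `X` is an (order) ideal if `y ∈ I` whenever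
`|y| ≤ |x|` for some `x ∈ I`. -/
def IsOrderIdeal {X : Type*} [AddCommGroup X] [Module ℝ X] [Lattice X]
    (I : Submodule ℝ X) : Prop :=
  ∀ x ∈ I, ∀ y : X, |y| ≤ |x| → y ∈ I

/-!
Since `C(K, ℝ)` is separable, `K` is metrizable. Subtracting the value at `0`, the order isomorphism
becomes an order embedding `t : E ↪o C(K, ℝ)` with `t 0 = 0` and range the closed ideal `I`; it
preserves finite suprema and, because `I` is an ideal, disjointness of positive elements.

The only topological information that has to be extracted from `t` is continuity at `0` along the
positive cone (`exists_norm_map_le`). Every sequence tending to `0` fast enough in `E` is dominated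
by `2⁻ᵏ u` for a fixed `u ≥ 0`, so it suffices that the decreasing sequence `t (2⁻ᵏ u)` tends to `0`
in norm; by compactness this holds if it tends to `0` pointwise
(`exists_map_half_pow_apply_lt`). Suppose instead that `t (2⁻ᵏ u) p ≥ ε` for all `k`. If `p` is
isolated, then `ε` times the indicator of `{p}` is the image of an element below every `2⁻ᵏ u`,
which is impossible. Otherwise there are points `q k → p` and disjoint bumps `g k ≤ t (2⁻ᵏ u)` with
`g k (q k) = ε / 2`. Write `g k = t (b k)`. The `b k` are disjoint and absolutely summable, so
`x = ∑ b (2k)` and `y = ∑ b (2k+1)` are disjoint; hence so are `t x` and `t y`. But both are at least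
`ε / 2` at `p`, by continuity.

It follows that finite suprema of positive elements of the unit ball of `E` are norm bounded
(`exists_norm_le_of_mem_supClosure_posBall`). Otherwise there are `x j` with `‖x j‖ > j`, each a
finite supremum of positive elements so small that `‖t (x j)‖ ≤ 2⁻ʲ`: a small supremum norm
survives finite suprema. Then `∑ t (x j)` belongs to `I`, so it is some `t v`, and `x j ≤ v` for
all `j`, which contradicts `‖x j‖ > j`.

Finally, this boundedness characterizes the Banach lattices which are isomorphic to AM-spaces: the
infimum `amGauge x` of the radii `r` such that `|x|` lies below a finite supremum of positive elements
of norm at most `r` is an equivalent solid M-norm.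
-/

open Filter Topology

/-! ### Metrizability of `K` -/

/-- A dense sequence in `C(K, ℝ)` separates the points of `K`, so it embeds `K` into `ℕ → ℝ`. -/
theorem metrizableSpace_of_separableSpace_continuousMap (K : Type*) [TopologicalSpace K]
    [CompactSpace K] [T2Space K] [TopologicalSpace.SeparableSpace C(K, ℝ)] :
    TopologicalSpace.MetrizableSpace K := by
  let F : K → ℕ → ℝ := fun x n => TopologicalSpace.denseSeq C(K, ℝ) n x
  have hF : Continuous F := by fun_prop
  have hinj : Function.Injective F := by
    intro x y hxy
    by_contra hne
    obtain ⟨f, hf0, hf1, -⟩ := exists_continuous_zero_one_of_isClosed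
      (isClosed_singleton (x := x)) (isClosed_singleton (x := y)) (by simpa using hne)
    have hclosed : IsClosed {g : C(K, ℝ) | g x = g y} :=
      isClosed_eq (by fun_prop) (by fun_prop)
    have huniv : {g : C(K, ℝ) | g x = g y} = Set.univ := by
      rw [← hclosed.closure_eq]
      refine ((TopologicalSpace.denseRange_denseSeq C(K, ℝ)).mono ?_).closure_eq
      rintro _ ⟨n, rfl⟩
      exact congrFun hxy n
    have hfxy : f x = f y := by
      have : f ∈ {g : C(K, ℝ) | g x = g y} := huniv ▸ Set.mem_univ f
      exact this
    rw [hf0 rfl, hf1 rfl] at hfxy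
    exact zero_ne_one hfxy
  exact (hF.isClosedEmbedding hinj).isEmbedding.metrizableSpace

/-! ### Disjoint elements of normed lattices -/

section NormedLattice

theorem add_inf_eq_zero {E : Type*} [AddCommGroup E] [Lattice E] [IsOrderedAddMonoid E] {x y c : E}
    (hx : 0 ≤ x) (hy : 0 ≤ y) (hc : 0 ≤ c) (hxc : x ⊓ c = 0)
    (hyc : y ⊓ c = 0) : (x + y) ⊓ c = 0 := by
  refine le_antisymm ?_ (le_inf (add_nonneg hx hy) hc)
  have h1 : (x + y) ⊓ c - y ≤ x ⊓ c :=
    le_inf (sub_le_iff_le_add.2 inf_le_left) ((sub_le_self _ hy).trans inf_le_right)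
  rw [hxc, sub_nonpos] at h1
  exact (le_inf h1 inf_le_right).trans hyc.le

variable {E : Type*} [NormedAddCommGroup E] [Lattice E] [IsOrderedAddMonoid E] [HasSolidNorm E]

theorem norm_le_norm_of_nonneg_of_le {x y : E} (hx : 0 ≤ x) (hxy : x ≤ y) : ‖x‖ ≤ ‖y‖ :=
  norm_le_norm_of_abs_le_abs (by rwa [abs_of_nonneg hx, abs_of_nonneg (hx.trans hxy)])

theorem tsum_inf_eq_zero {b : ℕ → E} {c : E} (hb : ∀ k, 0 ≤ b k) (hs : Summable b) (hc : 0 ≤ c)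
    (h : ∀ k, b k ⊓ c = 0) : (∑' k, b k) ⊓ c = 0 := by
  have hpart : ∀ s : Finset ℕ, (∑ k ∈ s, b k) ⊓ c = 0 := by
    intro s
    induction s using Finset.cons_induction with
    | empty => simpa using hc
    | cons a s ha ih =>
      rw [Finset.sum_cons]
      exact add_inf_eq_zero (hb a) (Finset.sum_nonneg fun i _ => hb i) hc (h a) ih
  have ht : Tendsto (fun s : Finset ℕ => (∑ k ∈ s, b k) ⊓ c) atTop (𝓝 ((∑' k, b k) ⊓ c)) :=
    hs.hasSum.inf_nhds tendsto_const_nhds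
  simp only [hpart] at ht
  exact (tendsto_nhds_unique ht tendsto_const_nhds)

end NormedLattice

/-! ### Order embeddings onto an ideal of `C(K, ℝ)` -/

section OrderEmbedding

variable {E : Type*} [Lattice E] {K : Type*} [TopologicalSpace K]
  {I : Submodule ℝ C(K, ℝ)} {t : E ↪o C(K, ℝ)}

theorem exists_mem_of_le_map [Zero E] (hI : IsOrderIdeal I) (ht0 : t 0 = 0) (htI : Set.range t = I)
    {f : C(K, ℝ)} {x : E} (hf : 0 ≤ f) (hfx : f ≤ t x) : ∃ y, 0 ≤ y ∧ y ≤ x ∧ t y = f := by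
  have hx : t x ∈ I := by
    have : t x ∈ Set.range t := ⟨x, rfl⟩
    rwa [htI] at this
  have hfI : f ∈ Set.range t := by
    rw [htI]
    exact hI _ hx f (by rwa [abs_of_nonneg hf, abs_of_nonneg (hf.trans hfx)])
  obtain ⟨y, rfl⟩ := hfI
  exact ⟨y, t.le_iff_le.1 (by rwa [ht0]), t.le_iff_le.1 hfx, rfl⟩

theorem map_inf_map_eq_zero [Zero E] (hI : IsOrderIdeal I) (ht0 : t 0 = 0) (htI : Set.range t = I)
    {x y : E} (hx : 0 ≤ x) (hy : 0 ≤ y) (hxy : x ⊓ y = 0) : t x ⊓ t y = 0 := by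
  have hx' : 0 ≤ t x := by rw [← ht0]; exact t.monotone hx
  have hy' : 0 ≤ t y := by rw [← ht0]; exact t.monotone hy
  obtain ⟨z, hz0, hzx, hz⟩ := exists_mem_of_le_map hI ht0 htI (le_inf hx' hy') inf_le_left
  have hzy : z ≤ y := t.le_iff_le.1 (hz ▸ inf_le_right)
  rw [← hz, ← ht0, le_antisymm (hxy ▸ le_inf hzx hzy) hz0]

theorem inf_eq_zero_of_map_inf_map_eq_zero [Zero E] (ht0 : t 0 = 0) {x y : E} (hx : 0 ≤ x) (hy : 0 ≤ y)
    (hxy : t x ⊓ t y = 0) : x ⊓ y = 0 := by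
  refine le_antisymm (t.le_iff_le.1 ?_) (le_inf hx hy)
  rw [ht0, ← hxy]
  exact le_inf (t.monotone inf_le_left) (t.monotone inf_le_right)

theorem map_sup_of_isOrderIdeal (hI : IsOrderIdeal I) (htI : Set.range t = I) (x y : E) :
    t (x ⊔ y) = t x ⊔ t y := by
  have hm : ∀ z, t z ∈ I := fun z => by
    have : t z ∈ Set.range t := ⟨z, rfl⟩
    rwa [htI] at this
  have hmem : t x ⊔ t y ∈ Set.range t := by
    rw [htI]
    have habs : ∀ z, |t z| ∈ I := fun z => hI _ (hm z) _ (by rw [abs_abs])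
    refine hI _ (I.add_mem (habs x) (habs y)) _ ?_
    rw [abs_of_nonneg (add_nonneg (abs_nonneg (t x)) (abs_nonneg (t y)))]
    refine sup_le (sup_le ?_ ?_) ?_
    · exact (le_abs_self _).trans (le_add_of_nonneg_right (abs_nonneg _))
    · exact (le_abs_self _).trans (le_add_of_nonneg_left (abs_nonneg _))
    · rw [neg_sup]
      exact inf_le_left.trans ((neg_le_abs _).trans (le_add_of_nonneg_right (abs_nonneg _)))
  obtain ⟨z, hz⟩ := hmem
  refine le_antisymm ?_ (sup_le (t.monotone le_sup_left) (t.monotone le_sup_right))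
  rw [← hz]
  exact t.monotone (sup_le (t.le_iff_le.1 (hz ▸ le_sup_left)) (t.le_iff_le.1 (hz ▸ le_sup_right)))

theorem eq_zero_of_forall_le_map_half_pow {E : Type*} [NormedAddCommGroup E] [NormedSpace ℝ E]
    [Lattice E] [IsOrderedAddMonoid E] [HasSolidNorm E] {t : E ↪o C(K, ℝ)}
    (hI : IsOrderIdeal I) (ht0 : t 0 = 0)
    (htI : Set.range t = I) {u : E} {f : C(K, ℝ)} (hf : 0 ≤ f)
    (h : ∀ k : ℕ, f ≤ t ((1 / 2 : ℝ) ^ k • u)) : f = 0 := by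
  obtain ⟨b, hb0, -, rfl⟩ := exists_mem_of_le_map hI ht0 htI hf (h 0)
  have hb : ∀ k : ℕ, ‖b‖ ≤ (1 / 2 : ℝ) ^ k * ‖u‖ := fun k => by
    refine (norm_le_norm_of_nonneg_of_le hb0 (t.le_iff_le.1 (h k))).trans_eq ?_
    rw [norm_smul, Real.norm_of_nonneg (by positivity)]
  have hlim : Tendsto (fun k : ℕ => (1 / 2 : ℝ) ^ k * ‖u‖) atTop (𝓝 0) := by
    simpa using (tendsto_pow_atTop_nhds_zero_of_lt_one (r := (1 / 2 : ℝ))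
      (by norm_num) (by norm_num)).mul_const ‖u‖
  rw [norm_le_zero_iff.1 (ge_of_tendsto' hlim hb), ht0]

end OrderEmbedding

instance ContinuousMap.hasSolidNorm {K : Type*} [TopologicalSpace K] [CompactSpace K] :
    HasSolidNorm C(K, ℝ) :=
  ⟨fun f g hfg => (ContinuousMap.norm_le f (norm_nonneg g)).2 fun x =>
    (hfg x).trans (g.norm_coe_le_norm x)⟩

/-! ### Disjoint bumps accumulating at a point -/

section Bump

theorem exists_seq_dist_halving {K : Type*} [MetricSpace K] (p : K) [(𝓝[≠] p).NeBot]
    {δ : ℕ → ℝ} (hδ : ∀ k, 0 < δ k) :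
    ∃ q : ℕ → K, (∀ k, q k ≠ p) ∧ (∀ k, dist (q k) p < δ k) ∧
      ∀ k, dist (q (k + 1)) p ≤ dist (q k) p / 2 := by
  have hex : ∀ r : ℝ, ∃ q : K, 0 < r → q ≠ p ∧ dist q p < r := by
    intro r
    by_cases hr : 0 < r
    · have h1 : ∀ᶠ q in 𝓝[≠] p, q ∈ Metric.ball p r :=
        eventually_nhdsWithin_of_eventually_nhds (Metric.ball_mem_nhds p hr)
      obtain ⟨q, hq, hqp⟩ := (h1.and eventually_mem_nhdsWithin).exists
      exact ⟨q, fun _ => ⟨hqp, hq⟩⟩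
    · exact ⟨p, fun h => absurd h hr⟩
  choose c hc using hex
  let q : ℕ → K := fun n =>
    Nat.rec (c (δ 0)) (fun k x => c (min (δ (k + 1)) (dist x p / 2))) n
  have hstep : ∀ k, q k ≠ p → q (k + 1) ≠ p ∧
      dist (q (k + 1)) p < min (δ (k + 1)) (dist (q k) p / 2) := fun k hk =>
    hc (min (δ (k + 1)) (dist (q k) p / 2)) (lt_min (hδ _) (half_pos (dist_pos.2 hk)))
  have hne : ∀ k, q k ≠ p := by
    intro k
    induction k with
    | zero => exact (hc _ (hδ 0)).1
    | succ k ih => exact (hstep k ih).1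
  refine ⟨q, hne, fun k => ?_, fun k => ?_⟩
  · cases k with
    | zero => exact (hc _ (hδ 0)).2
    | succ k => exact (hstep k (hne k)).2.trans_le (min_le_left _ _)
  · exact (hstep k (hne k)).2.le.trans (min_le_right _ _)

/-- The tent function of height `a` on the shell `{x | |dist x p - r| < r / 4}` around `p`, peaking
where `dist x p = r`. Radial bumps can be made disjoint by comparing radii alone. -/
noncomputable def shellBump {K : Type*} [MetricSpace K] (p : K) (a r : ℝ) : C(K, ℝ) where
  toFun x := a * max 0 (1 - 4 * |dist x p - r| / r)
  continuous_toFun := by fun_prop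

variable {K : Type*} [MetricSpace K] {p : K} {a r : ℝ}

theorem shellBump_apply (x : K) :
    shellBump p a r x = a * max 0 (1 - 4 * |dist x p - r| / r) := rfl

theorem shellBump_nonneg (ha : 0 ≤ a) : 0 ≤ shellBump p a r := fun x => by
  change 0 ≤ shellBump p a r x
  rw [shellBump_apply]
  exact mul_nonneg ha (le_max_left _ _)

theorem shellBump_le (ha : 0 ≤ a) (hr : 0 < r) (x : K) : shellBump p a r x ≤ a := by
  rw [shellBump_apply]
  refine mul_le_of_le_one_right ha (max_le zero_le_one ?_)
  have : 0 ≤ 4 * |dist x p - r| / r := by positivity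
  linarith

theorem shellBump_apply_of_dist_eq {x : K} (hx : dist x p = r) : shellBump p a r x = a := by
  simp [shellBump_apply, hx]

theorem shellBump_eq_zero (hr : 0 < r) {x : K} (hx : r / 4 ≤ |dist x p - r|) :
    shellBump p a r x = 0 := by
  rw [shellBump_apply, max_eq_left, mul_zero]
  rw [sub_nonpos, one_le_div hr]
  linarith

/-- The shells have radii in `(3 / 4 r, 5 / 4 r)`, so those of `r` and of `s ≤ r / 2` are disjoint. -/
theorem shellBump_inf_shellBump (ha : 0 ≤ a) {s : ℝ} (hs : 0 < s) (hsr : s ≤ r / 2) :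
    shellBump p a r ⊓ shellBump p a s = 0 := by
  ext x
  rw [ContinuousMap.inf_apply, ContinuousMap.zero_apply]
  by_cases hx : r / 4 ≤ |dist x p - r|
  · rw [shellBump_eq_zero (by linarith) hx]
    exact inf_eq_left.2 (shellBump_nonneg ha x)
  · rw [shellBump_eq_zero (r := s) hs]
    · exact inf_eq_right.2 (shellBump_nonneg ha x)
    · rw [not_le, abs_lt] at hx
      exact le_abs.2 (Or.inl (by linarith [hx.1]))

end Bump

/-! ### Continuity at `0` on the positive cone -/

section Continuity

variable {E : Type*} [NormedAddCommGroup E] [NormedSpace ℝ E] [CompleteSpace E]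
  [Lattice E] [IsOrderedAddMonoid E] [IsOrderedModule ℝ E] [HasSolidNorm E]
  {K : Type*} [MetricSpace K]
  {I : Submodule ℝ C(K, ℝ)} {t : E ↪o C(K, ℝ)}

/-- Pointwise convergence of `t (2⁻ᵏ u)` to `0`. An order embedding need not turn an infimum of `0`
in the lattice sense into a pointwise infimum of `0`. That it does so here comes from splitting a
summable sequence of disjoint elements into its even and odd terms. -/
theorem exists_map_half_pow_apply_lt (hI : IsOrderIdeal I) (ht0 : t 0 = 0)
    (htI : Set.range t = I) {u : E} (hu : 0 ≤ u) {ε : ℝ} (hε : 0 < ε) (p : K) :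
    ∃ k : ℕ, t ((1 / 2 : ℝ) ^ k • u) p < ε := by
  by_contra! hp
  have hw : ∀ k : ℕ, 0 ≤ (1 / 2 : ℝ) ^ k • u := fun k => smul_nonneg (by positivity) hu
  have htw : ∀ k : ℕ, 0 ≤ t ((1 / 2 : ℝ) ^ k • u) := fun k => by
    rw [← ht0]; exact t.monotone (hw k)
  rcases eq_or_neBot (𝓝[≠] p) with hiso | hacc
  -- If `p` is isolated, `ε` times the indicator of `{p}` lies below every `t (2⁻ᵏ u)`.
  · have hclopen : IsClopen ({p} : Set K) :=
      ⟨isClosed_singleton, isOpen_singleton_iff_punctured_nhds p |>.2 hiso⟩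
    let f : C(K, ℝ) := ⟨({p} : Set K).indicator fun _ => ε,
      (continuous_const (y := ε)).indicator fun x hx => by
        rw [hclopen.frontier_eq] at hx; exact hx.elim⟩
    have hf0 : f = 0 := by
      refine eq_zero_of_forall_le_map_half_pow hI ht0 htI (u := u) ?_ fun k => ?_
      · exact fun x => Set.indicator_nonneg (fun _ _ => hε.le) x
      · intro x
        change ({p} : Set K).indicator (fun _ => ε) x ≤ t ((1 / 2 : ℝ) ^ k • u) x
        by_cases hx : x = p
        · simpa [hx] using hp k
        · simpa [hx] using htw k x
    have : f p = ε := Set.indicator_of_mem (Set.mem_singleton p) (fun _ => ε)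
    rw [hf0, ContinuousMap.zero_apply] at this
    exact hε.ne this
  · have hδ : ∀ k : ℕ, ∃ δ > 0, ∀ x, dist x p < δ → ε / 2 ≤ t ((1 / 2 : ℝ) ^ k • u) x := by
      intro k
      have hev : ∀ᶠ x in 𝓝 p, ε / 2 < t ((1 / 2 : ℝ) ^ k • u) x :=
        (t ((1 / 2 : ℝ) ^ k • u)).continuous.continuousAt.eventually_const_lt
          ((half_lt_self hε).trans_le (hp k))
      obtain ⟨δ, hδ, h⟩ := Metric.eventually_nhds_iff.1 hev
      exact ⟨δ, hδ, fun x hx => (h hx).le⟩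
    choose δ hδ0 hδ using hδ
    -- Half of `δ k`, since the bump around `q k` extends a little farther from `p` than `q k` does.
    obtain ⟨q, hqp, hqδ, hq2⟩ := exists_seq_dist_halving p (δ := fun k => δ k / 2)
      fun k => half_pos (hδ0 k)
    have hr : ∀ k, 0 < dist (q k) p := fun k => dist_pos.2 (hqp k)
    have hanti : Antitone fun k => dist (q k) p :=
      antitone_nat_of_succ_le fun k => (hq2 k).trans (half_le_self (hr k).le)
    have hq : Tendsto q atTop (𝓝 p) := by
      rw [tendsto_iff_dist_tendsto_zero]
      have hbd : ∀ k, dist (q k) p ≤ (1 / 2 : ℝ) ^ k * dist (q 0) p := by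
        intro k
        induction k with
        | zero => simp
        | succ k ih => rw [pow_succ]; linarith [hq2 k]
      refine squeeze_zero (fun k => dist_nonneg) hbd ?_
      simpa using (tendsto_pow_atTop_nhds_zero_of_lt_one (r := (1 / 2 : ℝ))
        (by norm_num) (by norm_num)).mul_const (dist (q 0) p)
    have hε2 : 0 ≤ ε / 2 := (half_pos hε).le
    let g : ℕ → C(K, ℝ) := fun k => shellBump p (ε / 2) (dist (q k) p)
    have hg : ∀ k, g k ≤ t ((1 / 2 : ℝ) ^ k • u) := by
      intro k x
      by_cases hx : dist (q k) p / 4 ≤ |dist x p - dist (q k) p|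
      · exact (shellBump_eq_zero (hr k) hx).trans_le (htw k x)
      · refine (shellBump_le hε2 (hr k) x).trans (hδ k x ?_)
        rw [not_le, abs_lt] at hx
        linarith [hx.2, hqδ k, hr k]
    -- The elements `b k` of `E` corresponding to the bumps are disjoint and absolutely summable.
    have hb := fun k => exists_mem_of_le_map hI ht0 htI (shellBump_nonneg hε2) (hg k)
    choose b hb0 hbw hbg using hb
    have hdisj_lt : ∀ i j, i < j → b i ⊓ b j = 0 := by
      intro i j hij
      refine inf_eq_zero_of_map_inf_map_eq_zero ht0 (hb0 i) (hb0 j) ?_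
      rw [hbg, hbg]
      exact shellBump_inf_shellBump hε2 (hr j) ((hanti (Nat.succ_le_of_lt hij)).trans (hq2 i))
    have hdisj : ∀ i j, i ≠ j → b i ⊓ b j = 0 := by
      intro i j hij
      rcases lt_or_gt_of_ne hij with h | h
      · exact hdisj_lt i j h
      · rw [inf_comm]; exact hdisj_lt j i h
    have hs : Summable b := by
      refine Summable.of_norm_bounded (g := fun k : ℕ => (1 / 2 : ℝ) ^ k * ‖u‖)
        (summable_geometric_two.mul_right _) fun k => ?_
      refine (norm_le_norm_of_nonneg_of_le (hb0 k) (hbw k)).trans_eq ?_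
      rw [norm_smul, Real.norm_of_nonneg (by positivity)]
    -- The sum over any subsequence dominates bumps of height `ε / 2` at points tending to `p`.
    have key : ∀ m : ℕ → ℕ, StrictMono m →
        ε / 2 ≤ t (∑' k, b (m k)) p := by
      intro m hm
      refine ge_of_tendsto' (((t (∑' k, b (m k))).continuous.tendsto p).comp
        (hq.comp hm.tendsto_atTop)) fun k => ?_
      have h1 : b (m k) ≤ ∑' k, b (m k) :=
        (hs.comp_injective hm.injective).le_tsum k fun j _ => hb0 _
      have h2 : t (b (m k)) (q (m k)) = ε / 2 := by
        rw [hbg, shellBump_apply_of_dist_eq rfl]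
      exact h2.symm.trans_le (t.monotone h1 (q (m k)))
    have hme : StrictMono fun k : ℕ => 2 * k := fun i j h => by dsimp only; omega
    have hmo : StrictMono fun k : ℕ => 2 * k + 1 := fun i j h => by dsimp only; omega
    have hse : Summable fun k => b (2 * k) := hs.comp_injective hme.injective
    have hso : Summable fun k => b (2 * k + 1) := hs.comp_injective hmo.injective
    have hx0 : 0 ≤ ∑' k, b (2 * k) := tsum_nonneg fun k => hb0 _
    have hy0 : 0 ≤ ∑' k, b (2 * k + 1) := tsum_nonneg fun k => hb0 _
    have hxy : (∑' k, b (2 * k)) ⊓ (∑' k, b (2 * k + 1)) = 0 := by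
      refine tsum_inf_eq_zero (fun k => hb0 _) hse hy0 fun i => ?_
      rw [inf_comm]
      exact tsum_inf_eq_zero (fun k => hb0 _) hso (hb0 _) fun j => hdisj _ _ (by omega)
    have h0 := DFunLike.congr_fun (map_inf_map_eq_zero hI ht0 htI hx0 hy0 hxy) p
    rw [ContinuousMap.inf_apply, ContinuousMap.zero_apply] at h0
    have := le_inf (key _ hme) (key _ hmo)
    rw [h0] at this
    linarith

/-- Dini's argument upgrades pointwise convergence of the decreasing sequence `t (2⁻ᵏ u)` to uniform
convergence. -/
theorem exists_norm_map_half_pow_le [CompactSpace K] (hI : IsOrderIdeal I) (ht0 : t 0 = 0)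
    (htI : Set.range t = I) {u : E} (hu : 0 ≤ u) {ε : ℝ} (hε : 0 < ε) :
    ∃ k : ℕ, ‖t ((1 / 2 : ℝ) ^ k • u)‖ ≤ ε := by
  by_contra! h
  have htw : ∀ k : ℕ, 0 ≤ t ((1 / 2 : ℝ) ^ k • u) := fun k => by
    rw [← ht0]; exact t.monotone (smul_nonneg (by positivity) hu)
  have hne : (⋂ k : ℕ, {x | ε ≤ t ((1 / 2 : ℝ) ^ k • u) x}).Nonempty := by
    refine IsCompact.nonempty_iInter_of_sequence_nonempty_isCompact_isClosed _
      (fun k x hx => ?_) (fun k => ?_) ?_ fun k => ?_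
    · refine le_trans (Set.mem_ofPred.1 hx) (t.monotone ?_ x)
      exact smul_le_smul_of_nonneg_right
        (pow_le_pow_of_le_one (by norm_num) (by norm_num) k.le_succ) hu
    · by_contra hem
      rw [Set.not_nonempty_iff_eq_empty, Set.eq_empty_iff_forall_notMem] at hem
      refine (h k).not_ge ((ContinuousMap.norm_le _ hε.le).2 fun x => ?_)
      have hx : 0 ≤ t ((1 / 2 : ℝ) ^ k • u) x := htw k x
      rw [Real.norm_of_nonneg hx]
      exact (not_le.1 (hem x)).le
    · exact (isClosed_le continuous_const (map_continuous _)).isCompact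
    · exact isClosed_le continuous_const (map_continuous _)
  obtain ⟨p, hp⟩ := hne
  obtain ⟨k, hk⟩ := exists_map_half_pow_apply_lt hI ht0 htI hu hε p
  exact hk.not_ge (Set.mem_iInter.1 hp k)

theorem exists_norm_map_le [CompactSpace K] (hI : IsOrderIdeal I) (ht0 : t 0 = 0)
    (htI : Set.range t = I) {ε : ℝ} (hε : 0 < ε) :
    ∃ δ > 0, ∀ z : E, 0 ≤ z → ‖z‖ ≤ δ → ‖t z‖ ≤ ε := by
  by_contra! h
  -- A sequence of norm at most `4⁻ᵏ` leaves room for the weights `2ᵏ`, so that `z k ≤ 2⁻ᵏ u`.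
  choose z hz0 hz hzε using fun k : ℕ => h ((1 / 4 : ℝ) ^ k) (by positivity)
  have hs : Summable fun k => (2 : ℝ) ^ k • z k := by
    refine Summable.of_norm_bounded summable_geometric_two fun k => ?_
    rw [norm_smul, Real.norm_of_nonneg (by positivity)]
    calc (2 : ℝ) ^ k * ‖z k‖ ≤ 2 ^ k * (1 / 4) ^ k := by gcongr; exact hz k
      _ = (1 / 2) ^ k := by rw [← mul_pow]; norm_num
  have hterm : ∀ k, 0 ≤ (2 : ℝ) ^ k • z k := fun k => smul_nonneg (by positivity) (hz0 k)
  obtain ⟨k, hk⟩ := exists_norm_map_half_pow_le hI ht0 htI (tsum_nonneg hterm) hε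
  refine (hzε k).not_ge (le_trans (norm_le_norm_of_nonneg_of_le ?_ (t.monotone ?_)) hk)
  · rw [← ht0]; exact t.monotone (hz0 k)
  · have h1 := smul_le_smul_of_nonneg_left (hs.le_tsum k fun j _ => hterm j)
      (by positivity : (0 : ℝ) ≤ (1 / 2) ^ k)
    rwa [smul_smul, ← mul_pow, show (1 / 2 * 2 : ℝ) = 1 by norm_num, one_pow, one_smul] at h1

end Continuity

/-! ### The gauge of finite suprema of positive elements -/

section AMGauge

variable {E : Type*} [NormedAddCommGroup E] [Lattice E]

variable (E) in
/-- The positive part of the closed ball of radius `r` around `0`. -/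
def posBall (r : ℝ) : Set E := {a | 0 ≤ a ∧ ‖a‖ ≤ r}

theorem nonneg_of_mem_supClosure_posBall {r : ℝ} {y : E} (hy : y ∈ supClosure (posBall E r)) :
    0 ≤ y :=
  supClosure_min (t := {y | 0 ≤ y}) (fun _ h => h.1) (fun _ ha _ _ => le_sup_of_le_left ha) hy

theorem radius_nonneg_of_mem_supClosure_posBall {r : ℝ} {y : E}
    (hy : y ∈ supClosure (posBall E r)) : 0 ≤ r := by
  by_contra hr
  have : posBall E r = ∅ :=
    Set.eq_empty_of_forall_notMem fun a ha => hr ((norm_nonneg a).trans ha.2)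
  simp [this] at hy

theorem supClosure_posBall_mono {r s : ℝ} (hrs : r ≤ s) :
    supClosure (posBall E r) ⊆ supClosure (posBall E s) :=
  supClosure_mono fun _ h => ⟨h.1, h.2.trans hrs⟩

theorem add_mem_supClosure_posBall [IsOrderedAddMonoid E] {r s : ℝ} {y z : E}
    (hy : y ∈ supClosure (posBall E r)) (hz : z ∈ supClosure (posBall E s)) :
    y + z ∈ supClosure (posBall E (r + s)) := by
  refine supClosure_min (t := {y | y + z ∈ supClosure (posBall E (r + s))}) (fun a ha => ?_)
    (fun a ha b hb => ?_) hy
  · refine supClosure_min (t := {z | a + z ∈ supClosure (posBall E (r + s))}) (fun b hb => ?_)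
      (fun b hb c hc => ?_) hz
    · exact subset_supClosure
        ⟨add_nonneg ha.1 hb.1, (norm_add_le _ _).trans (add_le_add ha.2 hb.2)⟩
    · change a + b ⊔ c ∈ supClosure (posBall E (r + s))
      rw [add_sup]
      exact supClosed_supClosure hb hc
  · change (a ⊔ b) + z ∈ supClosure (posBall E (r + s))
    rw [sup_add]
    exact supClosed_supClosure ha hb

theorem smul_mem_supClosure_posBall [IsOrderedAddMonoid E] [NormedSpace ℝ E]
    [IsOrderedModule ℝ E] {c r : ℝ} (hc : 0 < c) {y : E}
    (hy : y ∈ supClosure (posBall E r)) : c • y ∈ supClosure (posBall E (c * r)) := by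
  refine supClosure_min (t := {y | c • y ∈ supClosure (posBall E (c * r))}) (fun a ha => ?_)
    (fun a ha b hb => ?_) hy
  · refine subset_supClosure ⟨smul_nonneg hc.le ha.1, ?_⟩
    rw [norm_smul, Real.norm_of_nonneg hc.le]
    exact mul_le_mul_of_nonneg_left ha.2 hc.le
  · change c • (a ⊔ b) ∈ supClosure (posBall E (c * r))
    rw [show c • (a ⊔ b) = c • a ⊔ c • b from (OrderIso.smulRight hc).map_sup a b]
    exact supClosed_supClosure ha hb

/-- The infimum of the radii `r` such that `|x|` is dominated by a finite supremum of positive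
elements of norm at most `r`. It is the largest solid gauge below the norm that turns suprema of
positive elements into maxima. -/
noncomputable def amGauge (x : E) : ℝ :=
  sInf {r | ∃ y ∈ supClosure (posBall E r), |x| ≤ y}

theorem amGauge_le {x y : E} {r : ℝ} (hy : y ∈ supClosure (posBall E r)) (hxy : |x| ≤ y) :
    amGauge x ≤ r :=
  csInf_le ⟨0, fun _ ⟨_, h, _⟩ => radius_nonneg_of_mem_supClosure_posBall h⟩ ⟨y, hy, hxy⟩

section

variable [IsOrderedAddMonoid E] [HasSolidNorm E]

theorem abs_mem_supClosure_posBall (x : E) : |x| ∈ supClosure (posBall E ‖x‖) :=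
  subset_supClosure ⟨abs_nonneg x, (norm_abs_eq_norm x).le⟩

theorem amGauge_le_norm (x : E) : amGauge x ≤ ‖x‖ :=
  amGauge_le (abs_mem_supClosure_posBall x) le_rfl

theorem amGauge_nonneg (x : E) : 0 ≤ amGauge x :=
  le_csInf ⟨_, _, abs_mem_supClosure_posBall x, le_rfl⟩
    fun _ ⟨_, h, _⟩ => radius_nonneg_of_mem_supClosure_posBall h

theorem exists_abs_le_of_amGauge_lt {x : E} {r : ℝ} (h : amGauge x < r) :
    ∃ y ∈ supClosure (posBall E r), |x| ≤ y := by
  have hne : {r | ∃ y ∈ supClosure (posBall E r), |x| ≤ y}.Nonempty :=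
    ⟨‖x‖, |x|, abs_mem_supClosure_posBall x, le_rfl⟩
  obtain ⟨s, ⟨y, hy, hxy⟩, hs⟩ := exists_lt_of_csInf_lt hne h
  exact ⟨y, supClosure_posBall_mono hs.le hy, hxy⟩

theorem amGauge_le_amGauge {x y : E} (h : |x| ≤ |y|) : amGauge x ≤ amGauge y := by
  refine le_of_forall_gt fun r hr => ?_
  obtain ⟨s, hs, hsr⟩ := exists_between hr
  obtain ⟨z, hz, hyz⟩ := exists_abs_le_of_amGauge_lt hs
  exact (amGauge_le hz (h.trans hyz)).trans_lt hsr

theorem amGauge_add_le (x y : E) : amGauge (x + y) ≤ amGauge x + amGauge y := by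
  refine le_of_forall_pos_le_add fun ε hε => ?_
  obtain ⟨a, ha, hxa⟩ := exists_abs_le_of_amGauge_lt (lt_add_of_pos_right (amGauge x) (half_pos hε))
  obtain ⟨b, hb, hyb⟩ := exists_abs_le_of_amGauge_lt (lt_add_of_pos_right (amGauge y) (half_pos hε))
  refine (amGauge_le (add_mem_supClosure_posBall ha hb)
    ((abs_add_le x y).trans (add_le_add hxa hyb))).trans_eq ?_
  ring

theorem amGauge_sup {x y : E} (hx : 0 ≤ x) (hy : 0 ≤ y) :
    amGauge (x ⊔ y) = max (amGauge x) (amGauge y) := by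
  have hxy : 0 ≤ x ⊔ y := le_sup_of_le_left hx
  refine le_antisymm ?_ (max_le (amGauge_le_amGauge ?_) (amGauge_le_amGauge ?_))
  · refine le_of_forall_pos_le_add fun ε hε => ?_
    obtain ⟨a, ha, hxa⟩ := exists_abs_le_of_amGauge_lt (x := x)
      ((le_max_left _ (amGauge y)).trans_lt (lt_add_of_pos_right _ hε))
    obtain ⟨b, hb, hyb⟩ := exists_abs_le_of_amGauge_lt (x := y)
      ((le_max_right (amGauge x) _).trans_lt (lt_add_of_pos_right _ hε))
    refine amGauge_le (supClosed_supClosure ha hb) ?_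
    rw [abs_of_nonneg hxy]
    exact sup_le_sup ((le_abs_self x).trans hxa) ((le_abs_self y).trans hyb)
  · rw [abs_of_nonneg hx, abs_of_nonneg hxy]; exact le_sup_left
  · rw [abs_of_nonneg hy, abs_of_nonneg hxy]; exact le_sup_right

variable [NormedSpace ℝ E] [IsOrderedModule ℝ E]

theorem amGauge_smul_le (c : ℝ) (x : E) : amGauge (c • x) ≤ |c| * amGauge x := by
  have hpos : ∀ c : ℝ, 0 < c → amGauge (c • x) ≤ c * amGauge x := by
    intro c hc
    refine le_of_forall_pos_le_add fun ε hε => ?_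
    obtain ⟨a, ha, hxa⟩ := exists_abs_le_of_amGauge_lt
      (lt_add_of_pos_right (amGauge x) (div_pos hε hc))
    refine (amGauge_le (smul_mem_supClosure_posBall hc ha) ?_).trans_eq ?_
    · have : |c • x| = c • |x| := by
        rw [abs, abs, ← smul_neg]
        exact ((OrderIso.smulRight hc).map_sup x (-x)).symm
      rw [this]
      exact smul_le_smul_of_nonneg_left hxa hc.le
    · field_simp
  rcases lt_trichotomy c 0 with hc | rfl | hc
  · rw [abs_of_neg hc]
    refine le_trans (amGauge_le_amGauge ?_) (hpos (-c) (neg_pos.2 hc))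
    rw [neg_smul, abs_neg]
  · simpa using amGauge_le_norm (0 : E)
  · rw [abs_of_pos hc]; exact hpos c hc

theorem norm_le_mul_amGauge {C : ℝ} (hC : ∀ y ∈ supClosure (posBall E 1), ‖y‖ ≤ C) (x : E) :
    ‖x‖ ≤ C * amGauge x := by
  have hr : ∀ r, amGauge x < r → ‖x‖ ≤ C * r := by
    intro r hxr
    have hr0 : 0 < r := (amGauge_nonneg x).trans_lt hxr
    obtain ⟨y, hy, hxy⟩ := exists_abs_le_of_amGauge_lt hxr
    have h1 := smul_mem_supClosure_posBall (inv_pos.2 hr0) hy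
    rw [inv_mul_cancel₀ hr0.ne'] at h1
    have h2 := hC _ h1
    rw [norm_smul, Real.norm_of_nonneg (inv_pos.2 hr0).le, inv_mul_le_iff₀ hr0, mul_comm] at h2
    refine (norm_le_norm_of_abs_le_abs ?_).trans h2
    rwa [abs_of_nonneg (nonneg_of_mem_supClosure_posBall hy)]
  have hlim : Tendsto (fun r => C * r) (𝓝[>] amGauge x) (𝓝 (C * amGauge x)) :=
    (tendsto_id.const_mul C).mono_left nhdsWithin_le_nhds
  exact ge_of_tendsto hlim (eventually_mem_nhdsWithin.mono hr)

end

end AMGauge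

/-! ### Renorming -/

section Renorming

variable {E : Type u} [NormedAddCommGroup E] [NormedSpace ℝ E] [CompleteSpace E]
  [Lattice E] [IsOrderedAddMonoid E] [IsOrderedModule ℝ E] [HasSolidNorm E]

/-- A copy of `E`, to carry a norm other than that of `E`. -/
def Renormed (E : Type u) : Type u := E

/-- If the finite suprema of positive elements of the unit ball are bounded in norm, then `amGauge` is
an M-norm equivalent to the norm of `E`. -/
theorem latticeIsomorphicToAMSpace_of_norm_le_of_mem_supClosure {C : ℝ}
    (hC : ∀ y ∈ supClosure (posBall E 1), ‖y‖ ≤ C) : LatticeIsomorphicToAMSpace E := by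
  let : AddCommGroup (Renormed E) := inferInstanceAs (AddCommGroup E)
  let : Module ℝ (Renormed E) := inferInstanceAs (Module ℝ E)
  let : Lattice (Renormed E) := inferInstanceAs (Lattice E)
  have : IsOrderedAddMonoid (Renormed E) := inferInstanceAs (IsOrderedAddMonoid E)
  have : IsOrderedModule ℝ (Renormed E) := inferInstanceAs (IsOrderedModule ℝ E)
  let N : AddGroupNorm (Renormed E) :=
    { toFun := amGauge (E := E)
      map_zero' := le_antisymm ((amGauge_le_norm (0 : E)).trans_eq norm_zero) (amGauge_nonneg _)
      add_le' := amGauge_add_le (E := E)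
      neg' := fun x => le_antisymm (amGauge_le_amGauge (E := E) (abs_neg (x : E)).le)
        (amGauge_le_amGauge (E := E) (abs_neg (x : E)).ge)
      eq_zero_of_map_eq_zero' := fun x (hx : amGauge (E := E) x = 0) => by
        have := norm_le_mul_amGauge hC x
        rw [hx, mul_zero] at this
        exact norm_le_zero_iff.1 this }
  let : NormedAddCommGroup (Renormed E) := N.toNormedAddCommGroup
  let : NormedSpace ℝ (Renormed E) := ⟨amGauge_smul_le (E := E)⟩
  let e : E ≃ₗ[ℝ] Renormed E := LinearEquiv.refl ℝ E
  have h1 : ∀ x : E, ‖e x‖ ≤ 1 * ‖x‖ := fun x =>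
    (amGauge_le_norm x).trans_eq (one_mul ‖x‖).symm
  have h2 : ∀ x : Renormed E, ‖e.symm x‖ ≤ C * ‖x‖ := fun x => norm_le_mul_amGauge hC (e.symm x)
  have hcomplete : CompleteSpace (Renormed E) :=
    (completeSpace_congr (e := e.toEquiv)
      (e.toContinuousLinearEquivOfBounds 1 C h1 h2).isUniformEmbedding).1 inferInstance
  exact ⟨Renormed E, inferInstance, inferInstance, hcomplete, inferInstance, inferInstance,
    inferInstance, ⟨fun _ _ h => amGauge_le_amGauge (E := E) h⟩,
    fun _ _ hx hy => amGauge_sup (E := E) hx hy, e, fun _ => rfl⟩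

end Renorming

/-! ### Boundedness of finite suprema -/

/-- Finite suprema of positive elements of the unit ball of `E` are bounded in norm: otherwise,
there would be unboundedly large ones with images small enough to be summed in the closed ideal, and
the preimage of that sum would dominate them all. -/
theorem exists_norm_le_of_mem_supClosure_posBall {E : Type*} [NormedAddCommGroup E]
    [NormedSpace ℝ E] [CompleteSpace E] [Lattice E] [IsOrderedAddMonoid E] [IsOrderedModule ℝ E]
    [HasSolidNorm E] {K : Type*} [MetricSpace K] [CompactSpace K] {I : Submodule ℝ C(K, ℝ)}
    {t : E ↪o C(K, ℝ)} (hI_closed : IsClosed (I : Set C(K, ℝ))) (hI : IsOrderIdeal I)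
    (ht0 : t 0 = 0) (htI : Set.range t = I) :
    ∃ C : ℝ, ∀ y ∈ supClosure (posBall E 1), ‖y‖ ≤ C := by
  by_contra! h
  have hnn : ∀ {x : E}, 0 ≤ x → 0 ≤ t x := fun hx => by rw [← ht0]; exact t.monotone hx
  choose δ hδ0 hδ using fun j : ℕ => exists_norm_map_le hI ht0 htI
    (ε := (1 / 2 : ℝ) ^ j) (by positivity)
  -- The factor `δ j` brings `y j` into the range where `t` is small, and `j / δ j` makes up for it.
  choose y hy hjy using fun j : ℕ => h ((j : ℝ) / δ j)
  have hx : ∀ j, δ j • y j ∈ supClosure (posBall E (δ j)) := fun j => by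
    simpa using smul_mem_supClosure_posBall (hδ0 j) (hy j)
  have hx0 : ∀ j, 0 ≤ t (δ j • y j) := fun j => hnn (nonneg_of_mem_supClosure_posBall (hx j))
  have htx : ∀ j, ‖t (δ j • y j)‖ ≤ (1 / 2 : ℝ) ^ j := by
    intro j
    refine (supClosure_min (t := {z | 0 ≤ z ∧ ‖t z‖ ≤ (1 / 2 : ℝ) ^ j})
      (fun a ha => ⟨ha.1, hδ j a ha.1 ha.2⟩) (fun a ha b hb => ?_) (hx j)).2
    refine ⟨le_sup_of_le_left ha.1, (ContinuousMap.norm_le _ (by positivity)).2 fun p => ?_⟩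
    have hpa : ‖t a p‖ ≤ (1 / 2 : ℝ) ^ j := ((t a).norm_coe_le_norm p).trans ha.2
    have hpb : ‖t b p‖ ≤ (1 / 2 : ℝ) ^ j := ((t b).norm_coe_le_norm p).trans hb.2
    rw [map_sup_of_isOrderIdeal hI htI, ContinuousMap.sup_apply]
    rcases max_choice (t a p) (t b p) with hm | hm <;> rw [hm] <;> assumption
  have hs : Summable fun j => t (δ j • y j) :=
    Summable.of_norm_bounded summable_geometric_two htx
  have hmem : ∑' j, t (δ j • y j) ∈ Set.range t := by
    rw [htI]
    refine hI_closed.mem_of_tendsto hs.hasSum (Eventually.of_forall fun s => ?_)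
    refine I.sum_mem fun j _ => ?_
    rw [← SetLike.mem_coe, ← htI]
    exact ⟨_, rfl⟩
  obtain ⟨v, hv⟩ := hmem
  have hle : ∀ j : ℕ, (j : ℝ) ≤ ‖v‖ := by
    intro j
    have h1 : δ j • y j ≤ v := t.le_iff_le.1 (by
      rw [hv]; exact hs.le_tsum j fun i _ => hx0 i)
    have h2 := norm_le_norm_of_nonneg_of_le (nonneg_of_mem_supClosure_posBall (hx j)) h1
    rw [norm_smul, Real.norm_of_nonneg (hδ0 j).le] at h2
    have h3 := (div_lt_iff₀' (hδ0 j)).1 (hjy j)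
    exact h3.le.trans h2
  obtain ⟨n, hn⟩ := exists_nat_gt ‖v‖
  exact (hle n).not_gt hn

theorem proposition3 (E : Type u) [NormedAddCommGroup E] [NormedSpace ℝ E] [CompleteSpace E]
    [Lattice E] [IsOrderedAddMonoid E] [IsOrderedModule ℝ E] [HasSolidNorm E]
    (K : Type v) [TopologicalSpace K] [CompactSpace K] [T2Space K]
    [TopologicalSpace.SeparableSpace C(K, ℝ)]
    (I : Submodule ℝ C(K, ℝ)) (hI_closed : IsClosed (I : Set C(K, ℝ))) (hI_ideal : IsOrderIdeal I)
    (hEI : Nonempty (E ≃o I)) :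
    LatticeIsomorphicToAMSpace E := by
  obtain ⟨T⟩ := hEI
  have := metrizableSpace_of_separableSpace_continuousMap K
  let := TopologicalSpace.metrizableSpaceMetric K
  let t : E ↪o C(K, ℝ) := OrderEmbedding.ofMapLEIff (fun x => (T x : C(K, ℝ)) - T 0)
    fun x y => by rw [sub_le_sub_iff_right, Subtype.coe_le_coe, T.le_iff_le]
  have ht0 : t 0 = 0 := sub_self _
  have htI : Set.range t = I := by
    ext f
    refine ⟨?_, fun hf => ⟨T.symm (⟨f, hf⟩ + T 0), ?_⟩⟩
    · rintro ⟨x, rfl⟩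
      exact I.sub_mem (T x).2 (T 0).2
    · change (T (T.symm (⟨f, hf⟩ + T 0)) : C(K, ℝ)) - T 0 = f
      simp
  obtain ⟨C, hC⟩ := exists_norm_le_of_mem_supClosure_posBall hI_closed hI_ideal ht0 htI
  exact latticeIsomorphicToAMSpace_of_norm_le_of_mem_supClosure hC
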